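/- Let $k$ be a field of characteristic $0$ with algebraic closure $\bar k$, let $d \ge 3$ be an integer, and let $f_{d-1}, f_d \in k[x_1,x_2,x_3]$ be nonzero homogeneous polynomials of degrees $d-1$ and $d$ such that $\gcd(f_{d-1},f_d)=1$ and such that the curves $Z(f_{d-1})$ and $Z(f_d)$ in $\mathbb{P}^2_{\bar k}$ have no common singular point. Put $F = x_0 f_{d-1} + f_d$; the surface $Z(F) \subset \mathbb{P}^3_{\bar k}$ is called a (normalized non-degenerate) monoid surface of degree $d$. Here a point is called singular on $Z(G)$, for a homogeneous polynomial $G$, if $G$ and all its first partial derivatives vanish there. Let $O = (1:0:0:0)$. Then $Z(F)$ has at most $\frac{1}{2}d(d-1)$ singular points in $\mathbb{P}^3_{\bar k}$ other than $O$; in particular there are only finitely many. If the number of singular points other than $O$ equals $\frac{1}{2}d(d-1)$, then every one of them is an $A_1$ singularity, that is, a local equation of $Z(F)$ at the point over $\bar k$, in an affine chart and with the point moved to the origin, becomes $x_1^2+x_2^2+x_3^2$ after a formal change of coordinates. -/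

import Mathlib

open scoped LinearAlgebra.Projectivization

namespace MonoidSurf

section
universe u

/-- `P` is a singular point of the projective hypersurface `Z(F)`, where `F` is homogeneous over `k`
and points have coordinates in the algebraic closure: `F` and all its partial derivatives vanish
at `P`. By homogeneity this does not depend on the representative of `P`. -/
def IsSingularPoint {k : Type u} [Field k] {n : ℕ} (F : MvPolynomial (Fin n) k)
    (P : ℙ (AlgebraicClosure k) (Fin n → AlgebraicClosure k)) : Prop :=
  MvPolynomial.aeval P.rep F = 0 ∧
    ∀ i, MvPolynomial.aeval P.rep (MvPolynomial.pderiv i F) = 0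

/-- The polynomial `F = x₀ f + g` in `k[x₀,x₁,x₂,x₃]`, where `f` and `g` are polynomials in
`x₁,x₂,x₃` (numbered by `Fin 3`, so that `Fin.succ` shifts them to their place). -/
noncomputable def monoidPoly {k : Type u} [Field k] (f g : MvPolynomial (Fin 3) k) :
    MvPolynomial (Fin 4) k :=
  MvPolynomial.X 0 * MvPolynomial.rename Fin.succ f + MvPolynomial.rename Fin.succ g

/-- `f = f_{d-1}` and `g = f_d` define a (normalized non-degenerate) monoid surface
`Z(x₀ f + g)` of degree `d` in projective 3-space. -/
structure IsMonoidSurface {k : Type u} [Field k] (d : ℕ) (f g : MvPolynomial (Fin 3) k) :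
    Prop where
  three_le : 3 ≤ d
  homogeneous_f : f.IsHomogeneous (d - 1)
  homogeneous_g : g.IsHomogeneous d
  f_ne_zero : f ≠ 0
  g_ne_zero : g ≠ 0
  /-- `gcd(f, g) = 1` in `k[x₁,x₂,x₃]`: every common divisor is a unit. -/
  gcd_eq_one : IsRelPrime f g
  no_common_singular_point :
    ¬ ∃ a : ℙ (AlgebraicClosure k) (Fin 3 → AlgebraicClosure k),
      IsSingularPoint f a ∧ IsSingularPoint g a

/-- The point `O = (1 : 0 : 0 : 0)`. -/
noncomputable def pointO (k : Type u) [Field k] :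
    ℙ (AlgebraicClosure k) (Fin 4 → AlgebraicClosure k) :=
  Projectivization.mk (AlgebraicClosure k) (Pi.single 0 1)
    (by intro h; simpa using congrFun h 0)

/-- The local equation of `Z(F)` at the point with homogeneous coordinates `p` in the affine chart
`x_i = 1` (meant for `p i ≠ 0`), with the point moved to the origin: the other coordinates
are replaced by `x_j + p_j / p_i`. -/
noncomputable def localEquation {k : Type u} [Field k] (F : MvPolynomial (Fin 4) k)
    (p : Fin 4 → AlgebraicClosure k) (i : Fin 4) : MvPolynomial (Fin 3) (AlgebraicClosure k) :=
  MvPolynomial.aeval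
    (i.insertNth (α := fun _ => MvPolynomial (Fin 3) (AlgebraicClosure k)) 1
      fun l => MvPolynomial.X l + MvPolynomial.C (p (i.succAbove l) / p i)) F

/-- A formal change of coordinates at the origin: three power series without constant term,
with invertible linear part. -/
def IsFormalCoordChange {K : Type u} [Field K] (φ : Fin 3 → MvPowerSeries (Fin 3) K) : Prop :=
  (∀ i, MvPowerSeries.constantCoeff (φ i) = 0) ∧
    (Matrix.of fun i j : Fin 3 => MvPowerSeries.coeff (Finsupp.single j 1) (φ i)).det ≠ 0

/-- Formal right equivalence: `g = h ∘ φ` for a formal change of coordinates `φ`. -/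
def RightEquivalent {K : Type u} [Field K] (g h : MvPowerSeries (Fin 3) K) : Prop :=
  ∃ φ : Fin 3 → MvPowerSeries (Fin 3) K, IsFormalCoordChange φ ∧ g = MvPowerSeries.subst φ h

/-- The normal form `x₁² + x₂² + x₃ⁿ⁺¹` of an `A_n` singularity. -/
noncomputable def normalFormA (K : Type u) [Field K] (n : ℕ) : MvPowerSeries (Fin 3) K :=
  MvPowerSeries.X 0 ^ 2 + MvPowerSeries.X 1 ^ 2 + MvPowerSeries.X 2 ^ (n + 1)

/-- `P` is an `A_n` singularity of `Z(F)`: the local equation of `Z(F)` at `P`, in an affine chart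
containing `P`, is right equivalent to the normal form. (The type does not depend on the chart or
on the representative, since a unit factor can be absorbed into the coordinates.) -/
def IsASingularity {k : Type u} [Field k] (n : ℕ) (F : MvPolynomial (Fin 4) k)
    (P : ℙ (AlgebraicClosure k) (Fin 4 → AlgebraicClosure k)) : Prop :=
  ∃ i : Fin 4, P.rep i ≠ 0 ∧
    RightEquivalent (localEquation F P.rep i : MvPowerSeries (Fin 3) (AlgebraicClosure k))
      (normalFormA (AlgebraicClosure k) n)

/-- The singular points of `Z(x₀ f + g)` other than `O`. -/
def otherSingularPoints {k : Type u} [Field k] (f g : MvPolynomial (Fin 3) k) :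
    Set (ℙ (AlgebraicClosure k) (Fin 4 → AlgebraicClosure k)) :=
  {P | IsSingularPoint (monoidPoly f g) P ∧ P ≠ pointO k}

end

end MonoidSurf

/-!
Write `F = x₀ f + g`. A point `(p₀ : a)` with `a ≠ 0` is singular on `Z(F)` exactly when
`f(a) = g(a) = 0` and `p₀ ∇f(a) + ∇g(a) = 0`. Since `f` and `g` have no common singular point,
`∇f(a) ≠ 0`; so `p₀` is determined by `a`, and distinct singular points other than `O` lie over
distinct points `a` of the plane. At each such point the curve `Z(f)` is smooth and `Z(g)` has
intersection multiplicity at least `2` with it, and Bézout's theorem bounds the number of these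
points by `d (d - 1) / 2`.

The multiplicities are carried by arcs. In affine coordinates `(x, y)` at `a` one has
`f = x A + y B` and `g + p₀ f = x² P + x y Q + y² R`, where `(A(0), B(0)) ≠ 0`. The polynomial
arc with velocity `(B(0), -A(0))` and a suitable acceleration kills `f` to order `3` and `g` to
order `2`; it kills `g` to order `3` as soon as the quadratic form
`U = P B² - Q A B + R A²` vanishes at the point (`exists_arc_of_local_form`).

The version of Bézout's theorem for arcs is `sum_le_mul_of_arcs`: if the coprime forms `f`, `g` of
degrees `m`, `n` vanish to order `e i` along immersed arcs `γ i` through distinct points, then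
`∑ e i ≤ m n`. In a large degree `E`, products of linear forms show that the forms of degree `E`
realize all truncated jets along the arcs, while the forms in the ideal `(f, g)` have zero jet and,
by the Koszul relations, codimension at most `m n`. Coprimality over `k` passes to the algebraic
closure because `k̄[x]` is free over `k[x]` (`dvd_of_dvd_mul_map_of_isRelPrime`).

If the number of singular points is `d (d - 1) / 2`, no arc can have order `3`, so `U ≠ 0` at
every point. Eliminating `x` (or `y`) by means of `f` then rewrites the local equation
`x₀ f + (g + p₀ f)` as `f · (x₀ + S) + y² U'` with `U'` a unit, which is a sum of three squares of
formal coordinates (`rightEquivalent_normalFormA_one`).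
-/

/-! ### Homogeneous polynomials and base change -/

namespace MvPolynomial

theorem finrank_homogeneousSubmodule_fin_three (K : Type*) [Field K] (n : ℕ) :
    Module.finrank K (homogeneousSubmodule (Fin 3) K n) = (n + 2).choose 2 := by
  have hset : {d : Fin 3 →₀ ℕ | d.degree = n} =
      ((Finset.univ : Finset (Fin 3)).finsuppAntidiag n : Set (Fin 3 →₀ ℕ)) := by
    ext d
    simp [Finset.mem_finsuppAntidiag, Finsupp.degree_eq_sum]
  have h : homogeneousSubmodule (Fin 3) K n =
      restrictSupport K ((Finset.univ : Finset (Fin 3)).finsuppAntidiag n : Set (Fin 3 →₀ ℕ)) := by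
    rw [homogeneousSubmodule_eq_finsupp_supported, hset]; rfl
  rw [h, Module.finrank_eq_nat_card_basis (basisRestrictSupport K _), Nat.card_coe_set_eq,
    Set.ncard_coe_finset, Finset.card_finsuppAntidiag_nat_eq_choose]
  rw [show (Finset.univ : Finset (Fin 3)).card + n - 1 = n + 2 by simp; omega,
    ← Nat.choose_symm_add]

theorem IsHomogeneous.exists_eq_mul_of_dvd {K σ : Type*} [Field K] {i j : ℕ}
    {g u : MvPolynomial σ K} (hg : g.IsHomogeneous i) (hu : u.IsHomogeneous (i + j))
    (h : g ∣ u) : ∃ w : MvPolynomial σ K, w.IsHomogeneous j ∧ u = g * w := by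
  obtain ⟨w, rfl⟩ := h
  let _ : GradedAlgebra (homogeneousSubmodule σ K) := MvPolynomial.gradedAlgebra
  have := DirectSum.coe_decompose_mul_add_of_left_mem (homogeneousSubmodule σ K) (i := i) (j := j)
    (b := w) hg
  rw [DirectSum.decompose_of_mem_same (homogeneousSubmodule σ K) hu] at this
  exact ⟨_, (DirectSum.decompose (homogeneousSubmodule σ K) w j).2, this⟩

theorem IsHomogeneous.aeval_smul {R S σ : Type*} [CommSemiring R] [CommSemiring S]
    [Algebra R S] {f : MvPolynomial σ R} {n : ℕ} (hf : f.IsHomogeneous n) (c : S) (a : σ → S) :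
    MvPolynomial.aeval (c • a) f = c ^ n * MvPolynomial.aeval a f := by
  rw [MvPolynomial.aeval_def, MvPolynomial.aeval_def, MvPolynomial.eval₂_eq,
    MvPolynomial.eval₂_eq, Finset.mul_sum]
  refine Finset.sum_congr rfl fun s hs => ?_
  simp only [Pi.smul_apply, smul_eq_mul, mul_pow, Finset.prod_mul_distrib,
    Finset.prod_pow_eq_pow_sum]
  rw [← hf.degree_eq_sum_deg_support hs]
  ring

/-- Coprimality survives an extension of the base field, in the form of cancellation: `K[x]` is free
over `k[x]`, so a divisibility over `K[x]` can be tested on the coordinates, which lie in `k[x]`. -/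
theorem dvd_of_dvd_mul_map_of_isRelPrime {k K σ : Type*} [Field k] [Field K] [Algebra k K]
    {f g : MvPolynomial σ k} (hfg : IsRelPrime f g) {u : MvPolynomial σ K}
    (h : map (algebraMap k K) g ∣ u * map (algebraMap k K) f) : map (algebraMap k K) g ∣ u := by
  let _ : Algebra (MvPolynomial σ k) (MvPolynomial σ K) := algebraMvPolynomial
  have e := (inferInstance : Algebra.IsPushout k (MvPolynomial σ k) K (MvPolynomial σ K)).out.equiv
  have : Module.Free (MvPolynomial σ k) (MvPolynomial σ K) := Module.Free.of_equiv e
  let B := Module.Free.chooseBasis (MvPolynomial σ k) (MvPolynomial σ K)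
  obtain ⟨w, hw⟩ := h
  have hw' : f • u = g • w := by
    simp only [Algebra.smul_def, MvPolynomial.algebraMap_def]
    rw [mul_comm, hw]
  have hd : ∀ i, g ∣ B.repr u i := fun i => by
    refine hfg.symm.dvd_of_dvd_mul_left ⟨B.repr w i, ?_⟩
    simpa using DFunLike.congr_fun (congrArg B.repr hw') i
  rw [← B.linearCombination_repr u, Finsupp.linearCombination_apply]
  refine Finset.dvd_sum fun i _ => ?_
  obtain ⟨c, hc⟩ := hd i
  refine ⟨c • B i, ?_⟩
  change B.repr u i • B i = _
  rw [hc, Algebra.smul_def, Algebra.smul_def, map_mul, mul_assoc]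
  rfl

end MvPolynomial

namespace MonoidSurf

/-! ### Interpolation of jets along arcs -/

section

open MvPolynomial

theorem exists_dual_eq_zero_ne_zero {K V : Type*} [Field K] [AddCommGroup V] [Module K V]
    {a b : V} (h : a ∉ Submodule.span K {b}) : ∃ c : Module.Dual K V, c b = 0 ∧ c a ≠ 0 := by
  obtain ⟨c, hc, hb⟩ := Submodule.exists_le_ker_of_notMem h
  exact ⟨c, hb (Submodule.mem_span_singleton_self b), hc⟩

/-- A linear functional, as a linear form; evaluating the form on an arc applies the functional to each
Taylor coefficient of the arc. -/
theorem exists_linearForm {K : Type*} [Field K] (c : Module.Dual K (Fin 3 → K)) :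
    ∃ L : MvPolynomial (Fin 3) K, L.IsHomogeneous 1 ∧ ∀ (γ : Fin 3 → Polynomial K) (r : ℕ),
      (aeval γ L).coeff r = c fun l => (γ l).coeff r := by
  refine ⟨∑ l, C (c (Pi.single l 1)) * X l,
    IsHomogeneous.sum _ _ _ fun l _ => isHomogeneous_C_mul_X _ _, fun γ r => ?_⟩
  conv_rhs => rw [← Finset.univ_sum_single fun l => (γ l).coeff r]
  rw [map_sum, map_sum, Polynomial.finsetSum_coeff]
  refine Finset.sum_congr rfl fun l _ => ?_
  have h : (Pi.single l ((γ l).coeff r) : Fin 3 → K) = (γ l).coeff r • Pi.single l 1 := by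
    rw [← Pi.single_smul, smul_eq_mul, mul_one]
  rw [h, map_smul]
  simp [mul_comm]

/-- Along the arc `γ i` the form vanishes to order exactly `s`, along the other arcs `γ j` to order at
least `e j`. It is a product of linear forms: `e j` of them through the base point of each `γ j`,
`s` of them through the base point of `γ i` but transverse to `γ i`, and the rest off that point. -/
theorem exists_form_with_leading_jet {K : Type*} [Field K] {ι : Type*} [Fintype ι]
    (γ : ι → Fin 3 → Polynomial K) (e : ι → ℕ)
    (h0 : ∀ i, (fun l => (γ i l).coeff 0) ≠ 0)
    (h1 : ∀ i, (fun l => (γ i l).coeff 1) ∉ Submodule.span K {fun l => (γ i l).coeff 0})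
    (h2 : ∀ i j, i ≠ j →
      (fun l => (γ i l).coeff 0) ∉ Submodule.span K {fun l => (γ j l).coeff 0})
    {E : ℕ} (hE : ∑ i, e i ≤ E) (i : ι) {s : ℕ} (hs : s < e i) :
    ∃ φ : MvPolynomial (Fin 3) K, φ.IsHomogeneous E ∧
      (∀ j, j ≠ i → Polynomial.X ^ e j ∣ aeval (γ j) φ) ∧
      ∃ c : Polynomial K, aeval (γ i) φ = Polynomial.X ^ s * c ∧ c.coeff 0 ≠ 0 := by
  classical
  have hM : ∃ M : MvPolynomial (Fin 3) K, M.IsHomogeneous 1 ∧ (aeval (γ i) M).coeff 0 ≠ 0 := by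
    obtain ⟨c, -, hc⟩ := exists_dual_eq_zero_ne_zero (K := K) (b := 0)
      (a := fun l => (γ i l).coeff 0) (by simpa using h0 i)
    obtain ⟨M, hM, h⟩ := exists_linearForm c
    exact ⟨M, hM, by rwa [h]⟩
  have hT : ∃ T : MvPolynomial (Fin 3) K, T.IsHomogeneous 1 ∧
      ∃ c : Polynomial K, aeval (γ i) T = Polynomial.X * c ∧ c.coeff 0 ≠ 0 := by
    obtain ⟨c, hc0, hc1⟩ := exists_dual_eq_zero_ne_zero (h1 i)
    obtain ⟨T, hT, h⟩ := exists_linearForm c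
    obtain ⟨q, hq⟩ := Polynomial.X_dvd_iff.2 ((h (γ i) 0).trans hc0)
    refine ⟨T, hT, q, hq, ?_⟩
    rwa [← h, hq, Polynomial.coeff_X_mul] at hc1
  have hL : ∀ j, ∃ L : MvPolynomial (Fin 3) K, j ≠ i → L.IsHomogeneous 1 ∧
      Polynomial.X ∣ aeval (γ j) L ∧ (aeval (γ i) L).coeff 0 ≠ 0 := by
    intro j
    by_cases hj : j = i
    · exact ⟨0, fun h => absurd hj h⟩
    obtain ⟨c, hc0, hc1⟩ := exists_dual_eq_zero_ne_zero (h2 i j (Ne.symm hj))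
    obtain ⟨L, hL, h⟩ := exists_linearForm c
    exact ⟨L, fun _ => ⟨hL, Polynomial.X_dvd_iff.2 ((h (γ j) 0).trans hc0), by rwa [h]⟩⟩
  obtain ⟨M, hMh, hM⟩ := hM
  obtain ⟨T, hTh, q, hq, hq0⟩ := hT
  choose L hL using hL
  have hsum : ∑ j ∈ Finset.univ.erase i, e j + e i ≤ E := by
    rwa [Finset.sum_erase_add _ _ (Finset.mem_univ i)]
  obtain ⟨r, hr⟩ := Nat.exists_eq_add_of_le (show ∑ j ∈ Finset.univ.erase i, e j + s ≤ E by omega)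
  refine ⟨(∏ j ∈ Finset.univ.erase i, L j ^ e j) * T ^ s * M ^ r, ?_, ?_, ?_⟩
  · rw [hr]
    refine .mul (.mul (.prod _ _ _ fun j hj => ?_) ?_) ?_
    · simpa using ((hL j (Finset.ne_of_mem_erase hj)).1).pow (e j)
    · simpa using hTh.pow s
    · simpa using hMh.pow r
  · intro j hj
    rw [map_mul, map_mul, map_prod]
    refine Dvd.dvd.mul_right (Dvd.dvd.mul_right (Dvd.dvd.trans ?_
      (Finset.dvd_prod_of_mem _ (Finset.mem_erase.2 ⟨hj, Finset.mem_univ j⟩))) _) _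
    rw [map_pow]
    exact pow_dvd_pow_of_dvd (hL j hj).2.1 _
  · refine ⟨(∏ j ∈ Finset.univ.erase i, aeval (γ i) (L j) ^ e j) * q ^ s * aeval (γ i) M ^ r,
      ?_, ?_⟩
    · simp only [map_mul, map_prod, map_pow, hq]
      ring
    · simp only [Polynomial.coeff_zero_eq_eval_zero] at hM hq0 hL ⊢
      simp only [Polynomial.eval_mul, Polynomial.eval_prod, Polynomial.eval_pow]
      refine mul_ne_zero (mul_ne_zero (Finset.prod_ne_zero_iff.2 fun j hj => ?_)
        (pow_ne_zero _ hq0)) (pow_ne_zero _ hM)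
      exact pow_ne_zero _ (hL j (Finset.ne_of_mem_erase hj)).2.2

/-- The truncated Taylor coefficients of a polynomial along finitely many arcs: those of order less
than `e i` along `γ i`. -/
noncomputable def jetMap {K : Type*} [Field K] {ι : Type*}
    (γ : ι → Fin 3 → Polynomial K) (e : ι → ℕ) :
    MvPolynomial (Fin 3) K →ₗ[K] ((i : ι) → Fin (e i) → K) :=
  LinearMap.pi fun i => LinearMap.pi fun s =>
    Polynomial.lcoeff K (s : ℕ) ∘ₗ (aeval (γ i)).toLinearMap

@[simp] theorem jetMap_apply {K : Type*} [Field K] {ι : Type*}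
    (γ : ι → Fin 3 → Polynomial K) (e : ι → ℕ) (φ : MvPolynomial (Fin 3) K) (i : ι)
    (s : Fin (e i)) : jetMap γ e φ i s = (aeval (γ i) φ).coeff s := rfl

/-- Forms of large degree realize all jets. For a fixed arc the forms of `exists_form_with_leading_jet`
are triangular with respect to the order of vanishing. -/
theorem map_jetMap_homogeneousSubmodule {K : Type*} [Field K] {ι : Type*} [Fintype ι]
    (γ : ι → Fin 3 → Polynomial K) (e : ι → ℕ)
    (h0 : ∀ i, (fun l => (γ i l).coeff 0) ≠ 0)
    (h1 : ∀ i, (fun l => (γ i l).coeff 1) ∉ Submodule.span K {fun l => (γ i l).coeff 0})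
    (h2 : ∀ i j, i ≠ j →
      (fun l => (γ i l).coeff 0) ∉ Submodule.span K {fun l => (γ j l).coeff 0})
    {E : ℕ} (hE : ∑ i, e i ≤ E) :
    (homogeneousSubmodule (Fin 3) K E).map (jetMap γ e) = ⊤ := by
  classical
  set W := (homogeneousSubmodule (Fin 3) K E).map (jetMap γ e) with hW
  -- Induction on the distance of `s` from the top order `e i`: the leading coefficient is cleared
  -- of the terms of higher order.
  have key : ∀ i (k : ℕ) (s : Fin (e i)), e i ≤ s + k →
      (Pi.single i (Pi.single s 1) : (i : ι) → Fin (e i) → K) ∈ W := by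
    intro i k
    induction k with
    | zero => intro s hs; have := s.2; omega
    | succ k ih =>
      intro s hs
      obtain ⟨φ, hφ, hφj, c, hc, hc0⟩ := exists_form_with_leading_jet γ e h0 h1 h2 hE i s.2
      have hexp : jetMap γ e φ = ∑ r : Fin (e i),
          (aeval (γ i) φ).coeff r • (Pi.single i (Pi.single r 1) : (i : ι) → Fin (e i) → K) := by
        ext j t
        rw [jetMap_apply]
        by_cases hj : j = i
        · subst hj
          simp [Finset.sum_apply, Pi.single_apply]
        · rw [Polynomial.X_pow_dvd_iff.1 (hφj j hj) t t.2]
          simp [Finset.sum_apply, Pi.single_eq_of_ne hj]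
      have hmem : jetMap γ e φ ∈ W := Submodule.mem_map_of_mem hφ
      rw [hexp, ← Finset.add_sum_erase _ _ (Finset.mem_univ s)] at hmem
      have hrest : ∑ r ∈ Finset.univ.erase s, (aeval (γ i) φ).coeff (r : ℕ) •
          (Pi.single i (Pi.single r 1) : (i : ι) → Fin (e i) → K) ∈ W := by
        refine Submodule.sum_mem _ fun r hr => ?_
        rcases lt_or_gt_of_ne (Finset.ne_of_mem_erase hr) with h | h
        · rw [hc, Polynomial.coeff_X_pow_mul', if_neg (by simpa using h), zero_smul]
          exact W.zero_mem
        · exact W.smul_mem _ (ih r (by have : (s : ℕ) < r := h; omega))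
      have := (W.add_mem_iff_left hrest).1 hmem
      refine (W.smul_mem_iff ?_).1 this
      rw [hc, Polynomial.coeff_X_pow_mul', if_pos le_rfl, Nat.sub_self]
      exact hc0
  rw [eq_top_iff]
  intro v _
  have hv : v = ∑ i, ∑ s, v i s • (Pi.single i (Pi.single s 1) : (i : ι) → Fin (e i) → K) := by
    ext j t
    rw [Finset.sum_apply, Finset.sum_apply, Finset.sum_eq_single j]
    · simp [Finset.sum_apply, Pi.single_apply]
    · intro i _ hi
      simp [Finset.sum_apply, Pi.single_eq_of_ne hi.symm]
    · simp
  rw [hv]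
  exact Submodule.sum_mem _ fun i _ => Submodule.sum_mem _ fun s _ =>
    W.smul_mem _ (key i (e i) s (Nat.le_add_left _ _))

/-! ### Bézout inequality for arcs -/

/-- Lower bound for the dimension of the degree `m + n + p` part of the ideal `(f, g)`: for coprime `f`
and `g` the only relations `u f + v g = 0` are the multiples of `g · f - f · g = 0`. -/
theorem finrank_add_le_of_isRelPrime {K : Type*} [Field K] {m n : ℕ}
    {f g : MvPolynomial (Fin 3) K} (hf : f.IsHomogeneous m) (hg : g.IsHomogeneous n)
    (hg0 : g ≠ 0) (hfg : ∀ u, g ∣ u * f → g ∣ u) (p : ℕ)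
    (I : Submodule K (homogeneousSubmodule (Fin 3) K (m + n + p)))
    (hfI : ∀ u (hu : (u * f).IsHomogeneous (m + n + p)), ⟨u * f, hu⟩ ∈ I)
    (hgI : ∀ u (hu : (u * g).IsHomogeneous (m + n + p)), ⟨u * g, hu⟩ ∈ I) :
    (n + p + 2).choose 2 + (m + p + 2).choose 2 ≤ Module.finrank K I + (p + 2).choose 2 := by
  have hfin : ∀ N, FiniteDimensional K (homogeneousSubmodule (Fin 3) K N) := fun N =>
    Module.Finite.iff_fg.2 (homogeneousSubmodule_fg (Fin 3) K N)
  have hu : ∀ u : homogeneousSubmodule (Fin 3) K (n + p),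
      (u.1 * f).IsHomogeneous (m + n + p) := fun u => by
    have := IsHomogeneous.mul u.2 hf
    rwa [show n + p + m = m + n + p by ring] at this
  have hv : ∀ u : homogeneousSubmodule (Fin 3) K (m + p),
      (u.1 * g).IsHomogeneous (m + n + p) := fun u => by
    have := IsHomogeneous.mul u.2 hg
    rwa [show m + p + n = m + n + p by ring] at this
  let ψ : homogeneousSubmodule (Fin 3) K (n + p) × homogeneousSubmodule (Fin 3) K (m + p) →ₗ[K]
      homogeneousSubmodule (Fin 3) K (m + n + p) :=
    { toFun := fun x => ⟨x.1.1 * f, hu x.1⟩ + ⟨x.2.1 * g, hv x.2⟩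
      map_add' := fun x y => Subtype.ext (by simp; ring)
      map_smul' := fun c x => Subtype.ext (by simp) }
  have hψI : LinearMap.range ψ ≤ I := by
    rintro _ ⟨x, rfl⟩
    exact I.add_mem (hfI _ _) (hgI _ _)
  -- The Koszul relations.
  let κ : homogeneousSubmodule (Fin 3) K p →ₗ[K]
      homogeneousSubmodule (Fin 3) K (n + p) × homogeneousSubmodule (Fin 3) K (m + p) :=
    { toFun := fun w => (⟨g * w.1, hg.mul w.2⟩, ⟨-(f * w.1), (hf.mul w.2).neg⟩)
      map_add' := fun x y => Prod.ext (Subtype.ext (by simp; ring)) (Subtype.ext (by simp; ring))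
      map_smul' := fun c x => Prod.ext (Subtype.ext (by simp)) (Subtype.ext (by simp)) }
  have hker : LinearMap.ker ψ ≤ LinearMap.range κ := by
    rintro ⟨u, v⟩ huv
    have huv' : u.1 * f + v.1 * g = 0 := congrArg Subtype.val huv
    obtain ⟨w, hw, huw⟩ := hg.exists_eq_mul_of_dvd u.2
      (hfg _ ⟨-v.1, by linear_combination huv'⟩)
    refine ⟨⟨w, hw⟩, Prod.ext (Subtype.ext huw.symm) (Subtype.ext ?_)⟩
    refine mul_right_cancel₀ hg0 ?_
    change -(f * w) * g = v.1 * g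
    rw [huw] at huv'
    linear_combination -huv'
  have e1 := LinearMap.finrank_range_add_finrank_ker ψ
  have e2 := LinearMap.finrank_range_le κ
  have e3 := Submodule.finrank_mono hψI
  have e4 := Submodule.finrank_mono hker
  rw [Module.finrank_prod] at e1
  simp only [finrank_homogeneousSubmodule_fin_three] at e1 e2
  omega

/-- Bézout inequality: coprime plane curves of degrees `m` and `n` that both vanish to order `e i`
along immersed arcs `γ i` with pairwise distinct base points satisfy `∑ e i ≤ m n`. -/
theorem sum_le_mul_of_arcs {K : Type*} [Field K] {m n : ℕ}
    {f g : MvPolynomial (Fin 3) K} (hf : f.IsHomogeneous m) (hg : g.IsHomogeneous n)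
    (hg0 : g ≠ 0) (hfg : ∀ u, g ∣ u * f → g ∣ u)
    {ι : Type*} [Fintype ι] (γ : ι → Fin 3 → Polynomial K) (e : ι → ℕ)
    (h0 : ∀ i, (fun l => (γ i l).coeff 0) ≠ 0)
    (h1 : ∀ i, (fun l => (γ i l).coeff 1) ∉ Submodule.span K {fun l => (γ i l).coeff 0})
    (h2 : ∀ i j, i ≠ j →
      (fun l => (γ i l).coeff 0) ∉ Submodule.span K {fun l => (γ j l).coeff 0})
    (hfγ : ∀ i, Polynomial.X ^ e i ∣ aeval (γ i) f)
    (hgγ : ∀ i, Polynomial.X ^ e i ∣ aeval (γ i) g) :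
    ∑ i, e i ≤ m * n := by
  -- The excess `p` of the degree `m + n + p` makes the jets surjective.
  set p := ∑ i, e i with hp
  have hfin : ∀ N, FiniteDimensional K (homogeneousSubmodule (Fin 3) K N) := fun N =>
    Module.Finite.iff_fg.2 (homogeneousSubmodule_fg (Fin 3) K N)
  let Λ := (jetMap γ e).domRestrict (homogeneousSubmodule (Fin 3) K (m + n + p))
  have hΛ : LinearMap.range Λ = ⊤ := by
    rw [LinearMap.range_domRestrict]
    exact map_jetMap_homogeneousSubmodule γ e h0 h1 h2 (Nat.le_add_left _ _)
  have hkill : ∀ φ : MvPolynomial (Fin 3) K, (∀ i, Polynomial.X ^ e i ∣ aeval (γ i) φ) →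
      ∀ u, jetMap γ e (u * φ) = 0 := fun φ hφ u => by
    ext i s
    rw [jetMap_apply, map_mul]
    exact Polynomial.X_pow_dvd_iff.1 ((hφ i).mul_left _) s s.2
  have e1 := LinearMap.finrank_range_add_finrank_ker Λ
  have e2 := finrank_add_le_of_isRelPrime hf hg hg0 hfg p (LinearMap.ker Λ)
    (fun u hu => hkill f hfγ u) (fun u hu => hkill g hgγ u)
  rw [hΛ, finrank_top, Module.finrank_pi_fintype, finrank_homogeneousSubmodule_fin_three] at e1
  simp only [Module.finrank_fin_fun] at e1
  have hch : ∀ x : ℕ, 2 * (x + 2).choose 2 = (x + 2) * (x + 1) := fun x => by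
    rw [Nat.choose_two_right, Nat.mul_div_cancel' (Nat.even_mul_pred_self _).two_dvd]; rfl
  have c1 := hch (m + n + p)
  have c2 := hch (n + p)
  have c3 := hch (m + p)
  have c4 := hch p
  rw [← hp] at e1
  nlinarith

end

/-! ### Formal normal form of a nondegenerate point -/

open MvPowerSeries in
theorem exists_mul_self_eq {K σ : Type*} [Field K] [IsAlgClosed K] [CharZero K]
    (U : MvPowerSeries σ K) (hU : constantCoeff U ≠ 0) : ∃ V : MvPowerSeries σ K, V * V = U := by
  obtain ⟨s, hs⟩ := IsAlgClosed.exists_pow_nat_eq (constantCoeff U) (n := 2) two_pos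
  -- `U = s² (1 + w)`, and `1 + w` has the binomial series of exponent `1 / 2` as square root.
  let w : MvPowerSeries σ K := C (constantCoeff U)⁻¹ * U - 1
  have hw : PowerSeries.HasSubst w := PowerSeries.HasSubst.of_constantCoeff_zero (by
    simp [w, hU])
  have hb : PowerSeries.binomialSeries K (1 / 2 : ℚ) * PowerSeries.binomialSeries K (1 / 2 : ℚ) =
      1 + PowerSeries.X := by
    rw [← PowerSeries.binomialSeries_add, add_halves]
    simpa using PowerSeries.binomialSeries_nat (R := ℚ) (A := K) 1
  refine ⟨C s * (PowerSeries.binomialSeries K (1 / 2 : ℚ)).subst w, ?_⟩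
  have h1 : (1 + PowerSeries.X : PowerSeries K).subst w = 1 + w := by
    rw [← PowerSeries.coe_substAlgHom hw, map_add, map_one, PowerSeries.substAlgHom_X]
  rw [mul_mul_mul_comm, ← PowerSeries.subst_mul hw, hb, h1, ← map_mul, ← pow_two, hs]
  rw [show (1 + w) = C (constantCoeff U)⁻¹ * U by simp [w], ← mul_assoc, ← map_mul,
    mul_inv_cancel₀ hU, map_one, one_mul]

open MvPowerSeries in
theorem coeff_single_X_mul {K : Type*} [Field K] (j l : Fin 3) (G : MvPowerSeries (Fin 3) K) :
    coeff (Finsupp.single j 1) (X l * G) = if j = l then constantCoeff G else 0 := by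
  classical
  by_cases h : j = l
  · subst h
    simpa [X] using coeff_add_monomial_mul (Finsupp.single j 1) 0 G (1 : K)
  · rw [if_neg h, X, coeff_monomial_mul, if_neg]
    intro hle
    simpa [Finsupp.single_apply, h] using hle l

open MvPowerSeries in
/-- The case of `rightEquivalent_normalFormA_one` in which the coefficient of the variable `u` in the
linear part of `X u * A + X v * B` is nonzero. -/
theorem rightEquivalent_normalFormA_one_aux {K : Type*} [Field K] [IsAlgClosed K] [CharZero K]
    (A B P Q R : MvPowerSeries (Fin 3) K) {u v : Fin 3} (huv : u = 1 ∧ v = 2 ∨ u = 2 ∧ v = 1)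
    (hA : constantCoeff A ≠ 0)
    (hU : constantCoeff P * constantCoeff B ^ 2 - constantCoeff Q * constantCoeff A *
      constantCoeff B + constantCoeff R * constantCoeff A ^ 2 ≠ 0) :
    RightEquivalent (X 0 * (X u * A + X v * B) +
      (X u ^ 2 * P + X u * X v * Q + X v ^ 2 * R)) (normalFormA K 1) := by
  obtain ⟨i, hi⟩ := IsAlgClosed.exists_pow_nat_eq (-1 : K) (n := 2) two_pos
  have hi0 : i ≠ 0 := by rintro rfl; simp at hi
  have hJ : A * A⁻¹ = 1 := MvPowerSeries.mul_inv_cancel A hA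
  have hJ0 : constantCoeff A⁻¹ = (constantCoeff A)⁻¹ := MvPowerSeries.constantCoeff_inv A
  set J := A⁻¹
  -- Substituting `X u = J (f - X v B)` leaves this coefficient of `X v ^ 2` modulo `f`.
  obtain ⟨V, hV⟩ := exists_mul_self_eq (R - J * B * (Q - J * B * P)) (by
    simp only [map_sub, map_mul, hJ0]
    intro h
    apply hU
    field_simp at h
    linear_combination h)
  have hV0 : constantCoeff V ≠ 0 := by
    intro h
    have h2 := congrArg constantCoeff hV
    simp only [map_mul, map_sub, h, hJ0] at h2
    apply hU
    field_simp at h2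
    linear_combination -h2
  set f := X u * A + X v * B with hf
  set S := X u * (J * P) + X v * (J * (Q - J * B * P)) with hS
  have hi' : (C i : MvPowerSeries (Fin 3) K) ^ 2 = -1 := by rw [← map_pow, hi]; simp
  have h2' : (C (1 / 2 : K) : MvPowerSeries (Fin 3) K) * 2 = 1 := by
    rw [← map_ofNat (C (σ := Fin 3) (R := K)) 2, ← map_mul]; simp
  -- `f (X 0 + S) = ((f + X 0 + S) / 2) ^ 2 + (i (f - X 0 - S) / 2) ^ 2` as `i ^ 2 = -1`.
  let φ : Fin 3 → MvPowerSeries (Fin 3) K :=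
    ![C (1 / 2 : K) * (f + X 0 + S), C i * (C (1 / 2 : K) * (f - X 0 - S)), X v * V]
  have hφ0 : ∀ j, constantCoeff (φ j) = 0 := by
    intro j
    fin_cases j <;> simp [φ, f, S]
  have hsub : HasSubst φ := hasSubst_of_constantCoeff_zero hφ0
  refine ⟨φ, ⟨hφ0, ?_⟩, ?_⟩
  · have hX : ∀ j : Fin 3, coeff (Finsupp.single j 1) (X 0 : MvPowerSeries (Fin 3) K) =
        if j = 0 then 1 else 0 := fun j => by
      simpa using coeff_single_X_mul j 0 (1 : MvPowerSeries (Fin 3) K)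
    rw [Matrix.det_fin_three]
    have hne : i * constantCoeff V * constantCoeff A ≠ 0 := mul_ne_zero (mul_ne_zero hi0 hV0) hA
    rcases huv with ⟨rfl, rfl⟩ | ⟨rfl, rfl⟩
    · intro h
      apply hne
      simp [φ, f, S, coeff_C_mul, hX, coeff_single_X_mul] at h
      linear_combination (norm := skip) 2 * h
      field_simp
      ring
    · intro h
      apply hne
      simp [φ, f, S, coeff_C_mul, hX, coeff_single_X_mul] at h
      linear_combination (norm := skip) -2 * h
      field_simp
      ring
  · rw [normalFormA, subst_add hsub, subst_add hsub, subst_pow hsub, subst_pow hsub,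
      subst_pow hsub, subst_X hsub, subst_X hsub, subst_X hsub]
    change _ = (C (1 / 2 : K) * (f + X 0 + S)) ^ 2 + (C i * (C (1 / 2 : K) * (f - X 0 - S))) ^ 2 +
      (X v * V) ^ 2
    have e1 : (C (1 / 2 : K) * (f + X 0 + S)) ^ 2 + (C i * (C (1 / 2 : K) * (f - X 0 - S))) ^ 2 +
      (X v * V) ^ 2 = f * (X 0 + S) + X v ^ 2 * (R - J * B * (Q - J * B * P)) := by
      rw [← hV]
      linear_combination (C (1 / 2 : K) * (f - X 0 - S)) ^ 2 * hi' +
        f * (X 0 + S) * (C (1 / 2 : K) * 2 + 1) * h2'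
    rw [e1, hS, hf]
    linear_combination (-(X u * X u * P) - X u * X v * (Q - J * B * P)) * hJ

open MvPowerSeries in
/-- The Morse lemma for a germ `x₀ (x₁ A + x₂ B) + (x₁² P + x₁ x₂ Q + x₂² R)`. The condition says that
the quadratic form of the second summand does not vanish in the direction `(B(0), -A(0))` tangent
to `x₁ A + x₂ B = 0`. -/
theorem rightEquivalent_normalFormA_one {K : Type*} [Field K] [IsAlgClosed K] [CharZero K]
    (A B P Q R : MvPowerSeries (Fin 3) K)
    (hU : constantCoeff P * constantCoeff B ^ 2 - constantCoeff Q * constantCoeff A *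
      constantCoeff B + constantCoeff R * constantCoeff A ^ 2 ≠ 0) :
    RightEquivalent (X 0 * (X 1 * A + X 2 * B) +
      (X 1 ^ 2 * P + X 1 * X 2 * Q + X 2 ^ 2 * R)) (normalFormA K 1) := by
  by_cases hA : constantCoeff A = 0
  · have hB : constantCoeff B ≠ 0 := fun hB => hU (by rw [hA, hB]; ring)
    convert rightEquivalent_normalFormA_one_aux B A R Q P (Or.inr ⟨rfl, rfl⟩) hB
      (fun h => hU (by linear_combination h)) using 1
    ring
  · exact rightEquivalent_normalFormA_one_aux A B P Q R (Or.inl ⟨rfl, rfl⟩) hA hU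

section

open MvPolynomial

/-! ### Local expansions and tangent arcs in the plane -/

theorem exists_eq_C_add_X_mul {K : Type*} [Field K] (p : MvPolynomial (Fin 2) K) :
    ∃ A B, p = C (constantCoeff p) + X 0 * A + X 1 * B := by
  induction p using MvPolynomial.induction_on with
  | C a => exact ⟨0, 0, by simp⟩
  | add p q hp hq =>
    obtain ⟨A, B, h⟩ := hp
    obtain ⟨A', B', h'⟩ := hq
    refine ⟨A + A', B + B', ?_⟩
    rw [map_add, map_add]
    linear_combination h + h'
  | mul_X p l hp =>
    fin_cases l
    · exact ⟨p, 0, by simp [mul_comm]⟩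
    · exact ⟨0, p, by simp [mul_comm]⟩

theorem constantCoeff_pderiv_X_mul_add {K : Type*} [Field K] (A B : MvPolynomial (Fin 2) K) :
    constantCoeff (pderiv 0 (X 0 * A + X 1 * B)) = constantCoeff A ∧
      constantCoeff (pderiv 1 (X 0 * A + X 1 * B)) = constantCoeff B := by
  constructor <;> simp [pderiv_X]

theorem exists_eq_quadratic {K : Type*} [Field K] {p : MvPolynomial (Fin 2) K}
    (h : constantCoeff p = 0) (hd : ∀ l, constantCoeff (pderiv l p) = 0) :
    ∃ P Q R, p = X 0 ^ 2 * P + X 0 * X 1 * Q + X 1 ^ 2 * R := by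
  obtain ⟨A, B, hp⟩ := exists_eq_C_add_X_mul p
  rw [h, map_zero, zero_add] at hp
  have hA := (constantCoeff_pderiv_X_mul_add A B).1
  have hB := (constantCoeff_pderiv_X_mul_add A B).2
  rw [← hp, hd] at hA hB
  obtain ⟨A0, A1, eA⟩ := exists_eq_C_add_X_mul A
  obtain ⟨B0, B1, eB⟩ := exists_eq_C_add_X_mul B
  rw [← hA, map_zero, zero_add] at eA
  rw [← hB, map_zero, zero_add] at eB
  refine ⟨A0, A1 + B0, B1, ?_⟩
  rw [hp]
  linear_combination X 0 * eA + X 1 * eB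

/-- The arc with velocity `(B(0), -A(0))`, tangent to `x A + y B = 0` at the origin. Its acceleration is
chosen so that `x A + y B` vanishes to third order along it; no assumption on `(A(0), B(0))` is
needed, since the required second-order correction is a combination of `A(0)` and `B(0)`. -/
theorem exists_tangent_arc {K : Type*} [Field K] (A B P Q R : MvPolynomial (Fin 2) K) :
    ∃ w : Fin 2 → K, ∀ δ : Fin 2 → Polynomial K,
      δ 0 = Polynomial.X * (Polynomial.C (constantCoeff B) + Polynomial.X * Polynomial.C (w 0)) →
      δ 1 = Polynomial.X * (-Polynomial.C (constantCoeff A) + Polynomial.X * Polynomial.C (w 1)) →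
      Polynomial.X ^ 3 ∣ aeval δ (X 0 * A + X 1 * B) ∧
      Polynomial.X ^ 2 ∣ aeval δ (X 0 ^ 2 * P + X 0 * X 1 * Q + X 1 ^ 2 * R) ∧
      (constantCoeff P * constantCoeff B ^ 2 - constantCoeff Q * constantCoeff A *
          constantCoeff B + constantCoeff R * constantCoeff A ^ 2 = 0 →
        Polynomial.X ^ 3 ∣ aeval δ (X 0 ^ 2 * P + X 0 * X 1 * Q + X 1 ^ 2 * R)) := by
  obtain ⟨A1, A2, eA⟩ := exists_eq_C_add_X_mul A
  obtain ⟨B1, B2, eB⟩ := exists_eq_C_add_X_mul B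
  set a := constantCoeff A
  set b := constantCoeff B
  refine ⟨![b * constantCoeff B1 - a * constantCoeff B2,
    a * constantCoeff A2 - b * constantCoeff A1], fun δ h0 h1 => ?_⟩
  simp only [Matrix.cons_val_zero, Matrix.cons_val_one] at h0 h1
  have hδ : ∀ p : MvPolynomial (Fin 2) K, (aeval δ p).eval 0 = constantCoeff p := by
    intro p
    obtain ⟨S, T, hST⟩ := exists_eq_C_add_X_mul p
    have h2 := congrArg (fun u => (aeval δ u).eval 0) hST
    simpa [h0, h1] using h2
  have hX : ∀ p : Polynomial K, p.eval 0 = 0 → Polynomial.X ∣ p := fun p hp =>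
    Polynomial.X_dvd_iff.2 (by rwa [Polynomial.coeff_zero_eq_eval_zero])
  have hA := congrArg (aeval δ) eA
  have hB := congrArg (aeval δ) eB
  simp only [map_add, map_mul, aeval_X, aeval_C, Polynomial.algebraMap_eq] at hA hB
  set w0 : Polynomial K := Polynomial.C (b * constantCoeff B1 - a * constantCoeff B2)
  set w1 : Polynomial K := Polynomial.C (a * constantCoeff A2 - b * constantCoeff A1)
  set ε0 : Polynomial K := Polynomial.C b + Polynomial.X * w0
  set ε1 : Polynomial K := -Polynomial.C a + Polynomial.X * w1
  have hf : aeval δ (X 0 * A + X 1 * B) = Polynomial.X ^ 2 *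
      (w0 * Polynomial.C a + w1 * Polynomial.C b +
        ε0 * (ε0 * aeval δ A1 + ε1 * aeval δ A2) + ε1 * (ε0 * aeval δ B1 + ε1 * aeval δ B2)) := by
    simp only [map_add, map_mul, aeval_X, hA, hB, h0, h1]
    ring
  have hh : aeval δ (X 0 ^ 2 * P + X 0 * X 1 * Q + X 1 ^ 2 * R) = Polynomial.X ^ 2 *
      (ε0 ^ 2 * aeval δ P + ε0 * ε1 * aeval δ Q + ε1 ^ 2 * aeval δ R) := by
    simp only [map_add, map_mul, map_pow, aeval_X, h0, h1]
    ring
  rw [hf, hh, pow_succ _ 2]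
  refine ⟨mul_dvd_mul_left _ (hX _ ?_), dvd_mul_right _ _, fun h => mul_dvd_mul_left _ (hX _ ?_)⟩
  · simp [ε0, ε1, w0, w1, hδ]
    ring
  · simp [ε0, ε1, w0, w1, hδ]
    linear_combination h

/-! ### Affine charts -/

/-- The parametrization `(x, y) ↦ (…, x + b₀, …, 1, …, y + b₁, …)` of the affine chart of the
projective plane where coordinate `i` equals `1`, centred at the point with affine
coordinates `b`. -/
noncomputable def chart {K : Type*} [Field K] (i : Fin 3) (b : Fin 2 → K) :
    Fin 3 → MvPolynomial (Fin 2) K :=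
  i.insertNth (α := fun _ => MvPolynomial (Fin 2) K) 1 fun l => X l + C (b l)

/-- The representative of a point of the projective plane that has coordinate `i` equal to `1`. -/
def chartPoint {K : Type*} [Field K] (i : Fin 3) (b : Fin 2 → K) : Fin 3 → K :=
  i.insertNth (α := fun _ => K) 1 b

theorem constantCoeff_aeval_chart {K : Type*} [Field K] (i : Fin 3) (b : Fin 2 → K)
    (f : MvPolynomial (Fin 3) K) :
    constantCoeff (aeval (chart i b) f) = eval (chartPoint i b) f := by
  induction f using MvPolynomial.induction_on with
  | C a => simp
  | add p q hp hq => rw [map_add, map_add, map_add, hp, hq]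
  | mul_X p j hp =>
    rw [map_mul, map_mul, map_mul, hp, aeval_X, eval_X]
    congr 1
    refine Fin.succAboveCases i ?_ (fun l => ?_) j <;> simp [chart, chartPoint]

theorem pderiv_aeval_chart {K : Type*} [Field K] (i : Fin 3) (b : Fin 2 → K) (l : Fin 2)
    (f : MvPolynomial (Fin 3) K) :
    pderiv l (aeval (chart i b) f) = aeval (chart i b) (pderiv (i.succAbove l) f) := by
  induction f using MvPolynomial.induction_on with
  | C a => simp [algebraMap_eq]
  | add p q hp hq => rw [map_add, map_add, map_add, map_add, hp, hq]
  | mul_X p j hp =>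
    have hj : pderiv l (chart i b j) =
        aeval (chart i b) (pderiv (i.succAbove l) (X j : MvPolynomial (Fin 3) K)) := by
      refine Fin.succAboveCases i ?_ (fun l' => ?_) j
      · simp [chart, pderiv_X]
      · by_cases h : l' = l
        · subst h
          simp [chart]
        · rw [pderiv_X_of_ne (by simpa using h)]
          simp [chart, pderiv_X_of_ne h]
    rw [map_mul, pderiv_mul, pderiv_mul, map_add, map_mul, map_mul, hp, aeval_X, hj]

theorem smul_eq_chartPoint {K : Type*} [Field K] {a : Fin 3 → K} {i : Fin 3} (hi : a i ≠ 0) :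
    (a i)⁻¹ • a = chartPoint i fun l => a (i.succAbove l) / a i := by
  funext j
  refine Fin.succAboveCases i ?_ (fun l => ?_) j
  · simp [chartPoint, hi]
  · simp [chartPoint, div_eq_inv_mul]

/-- The equations of a singular point in affine coordinates. The gradient of `f` is nonzero already in
the chart, by Euler's identity. -/
theorem exists_local_form {K : Type*} [Field K] {m : ℕ} {f g : MvPolynomial (Fin 3) K}
    (hf : f.IsHomogeneous m) {i : Fin 3} {b : Fin 2 → K} {q : K}
    (hf0 : eval (chartPoint i b) f = 0) (hg0 : eval (chartPoint i b) g = 0)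
    (hq : ∀ j, q * eval (chartPoint i b) (pderiv j f) + eval (chartPoint i b) (pderiv j g) = 0)
    (hns : ∃ j, eval (chartPoint i b) (pderiv j f) ≠ 0) :
    ∃ A B P Q R, aeval (chart i b) f = X 0 * A + X 1 * B ∧
      aeval (chart i b) g + C q * aeval (chart i b) f =
        X 0 ^ 2 * P + X 0 * X 1 * Q + X 1 ^ 2 * R ∧
      (constantCoeff A ≠ 0 ∨ constantCoeff B ≠ 0) := by
  obtain ⟨A, B, hAB⟩ := exists_eq_C_add_X_mul (aeval (chart i b) f)
  rw [constantCoeff_aeval_chart, hf0, map_zero, zero_add] at hAB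
  obtain ⟨P, Q, R, hPQR⟩ := exists_eq_quadratic
    (p := aeval (chart i b) g + C q * aeval (chart i b) f)
    (by rw [map_add, map_mul, constantCoeff_aeval_chart, constantCoeff_aeval_chart, hf0, hg0,
      mul_zero, add_zero])
    (fun l => by
      rw [map_add, pderiv_C_mul, pderiv_aeval_chart, pderiv_aeval_chart, map_add, map_mul,
        constantCoeff_aeval_chart, constantCoeff_aeval_chart, constantCoeff_C, add_comm]
      exact hq _)
  refine ⟨A, B, P, Q, R, hAB, hPQR, ?_⟩
  by_contra! hcon
  obtain ⟨hA, hB⟩ := hcon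
  have hA' := (constantCoeff_pderiv_X_mul_add A B).1
  have hB' := (constantCoeff_pderiv_X_mul_add A B).2
  rw [← hAB, pderiv_aeval_chart, constantCoeff_aeval_chart] at hA' hB'
  rw [hA] at hA'
  rw [hB] at hB'
  have hl : ∀ l, eval (chartPoint i b) (pderiv (i.succAbove l) f) = 0 := by
    intro l
    fin_cases l
    · exact hA'
    · exact hB'
  -- The only term left in Euler's identity is `∂f/∂xᵢ`, as coordinate `i` of the point is `1`.
  have heuler := congrArg (eval (chartPoint i b)) hf.sum_X_mul_pderiv
  rw [map_sum, Fin.sum_univ_succAbove _ i] at heuler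
  simp only [map_mul, eval_X, hl, mul_zero, Finset.sum_const_zero, add_zero, map_nsmul, hf0,
    smul_zero] at heuler
  have hi : eval (chartPoint i b) (pderiv i f) = 0 := by simpa [chartPoint] using heuler
  obtain ⟨j, hj⟩ := hns
  exact hj (Fin.succAboveCases i hi hl j)

/-- At a singular point both curves vanish to order `2` along an immersed arc, and to order `3` if the
quadratic part of `g + q f` vanishes in the tangent direction of `f`. -/
theorem exists_arc_of_local_form {K : Type*} [Field K] {f g : MvPolynomial (Fin 3) K}
    {i : Fin 3} {b : Fin 2 → K} {q : K} {A B P Q R : MvPolynomial (Fin 2) K}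
    (hAB : aeval (chart i b) f = X 0 * A + X 1 * B)
    (hPQR : aeval (chart i b) g + C q * aeval (chart i b) f =
        X 0 ^ 2 * P + X 0 * X 1 * Q + X 1 ^ 2 * R)
    (hns : constantCoeff A ≠ 0 ∨ constantCoeff B ≠ 0) :
    ∃ γ : Fin 3 → Polynomial K, (fun j => (γ j).coeff 0) = chartPoint i b ∧
      (fun j => (γ j).coeff 1) ∉ Submodule.span K {fun j => (γ j).coeff 0} ∧
      Polynomial.X ^ 3 ∣ aeval γ f ∧ Polynomial.X ^ 2 ∣ aeval γ g ∧
      (constantCoeff P * constantCoeff B ^ 2 - constantCoeff Q * constantCoeff A *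
          constantCoeff B + constantCoeff R * constantCoeff A ^ 2 = 0 →
        Polynomial.X ^ 3 ∣ aeval γ g) := by
  obtain ⟨w, hw⟩ := exists_tangent_arc A B P Q R
  let δ : Fin 2 → Polynomial K :=
    ![Polynomial.X * (Polynomial.C (constantCoeff B) + Polynomial.X * Polynomial.C (w 0)),
      Polynomial.X * (-Polynomial.C (constantCoeff A) + Polynomial.X * Polynomial.C (w 1))]
  obtain ⟨h1, h2, h3⟩ := hw δ rfl rfl
  rw [← hAB] at h1
  rw [← hPQR] at h2 h3
  let γ : Fin 3 → Polynomial K := i.insertNth (α := fun _ => Polynomial K) 1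
    fun l => δ l + Polynomial.C (b l)
  have hγ : ∀ p : MvPolynomial (Fin 3) K, aeval γ p = aeval δ (aeval (chart i b) p) := by
    intro p
    rw [← AlgHom.comp_apply, comp_aeval]
    congr 2
    funext j
    refine Fin.succAboveCases i ?_ (fun l => ?_) j <;> simp [γ, chart]
  have hg : aeval δ (aeval (chart i b) g) = aeval δ (aeval (chart i b) g +
      C q * aeval (chart i b) f) - Polynomial.C q * aeval δ (aeval (chart i b) f) := by
    simp
  have hcoeff0 : (fun j => (γ j).coeff 0) = chartPoint i b := by
    funext j
    refine Fin.succAboveCases i ?_ (fun l => ?_) j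
    · simp [γ, chartPoint]
    · fin_cases l <;> simp [γ, chartPoint, δ]
  refine ⟨γ, hcoeff0, ?_, ?_, ?_, ?_⟩
  · rw [hcoeff0, Submodule.mem_span_singleton]
    rintro ⟨c, hc⟩
    have hc0 : c = 0 := by
      have := congrFun hc i
      simpa [chartPoint, γ, Polynomial.coeff_one] using this
    have hl : ∀ l, (δ l).coeff 1 = 0 := fun l => by
      have := congrFun hc (i.succAbove l)
      simpa [hc0, γ, Polynomial.coeff_C] using this.symm
    have hl0 := hl 0
    have hl1 := hl 1
    simp [δ] at hl0 hl1
    rcases hns with h | h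
    · exact h hl1
    · exact h hl0
  · rw [hγ]; exact h1
  · rw [hγ, hg]
    exact dvd_sub h2 (((pow_dvd_pow _ (by norm_num)).trans h1).mul_left _)
  · intro h
    rw [hγ, hg]
    exact dvd_sub (h3 h) (h1.mul_left _)

theorem localEquation_monoidPoly {k : Type*} [Field k] (f g : MvPolynomial (Fin 3) k)
    (p : Fin 4 → AlgebraicClosure k) (i : Fin 3) :
    localEquation (monoidPoly f g) p i.succ =
      (X 0 + C (p 0 / p i.succ)) *
        rename Fin.succ (aeval (chart i fun l => p (i.succAbove l).succ / p i.succ) f) +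
      rename Fin.succ (aeval (chart i fun l => p (i.succAbove l).succ / p i.succ) g) := by
  have h0 : (i.succ.insertNth (α := fun _ => MvPolynomial (Fin 3) (AlgebraicClosure k)) 1
      fun l => X l + C (p (i.succ.succAbove l) / p i.succ)) 0 = X 0 + C (p 0 / p i.succ) := by
    have : (0 : Fin 4) = i.succ.succAbove 0 := by simp
    conv_lhs => rw [this]
    rw [Fin.insertNth_apply_succAbove]
    simp
  have hs : ∀ r : MvPolynomial (Fin 3) k,
      aeval (i.succ.insertNth (α := fun _ => MvPolynomial (Fin 3) (AlgebraicClosure k)) 1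
        fun l => X l + C (p (i.succ.succAbove l) / p i.succ)) (rename Fin.succ r) =
      rename Fin.succ (aeval (chart i fun l => p (i.succAbove l).succ / p i.succ) r) := by
    intro r
    rw [aeval_rename, ← AlgHom.restrictScalars_apply k (rename Fin.succ), ← AlgHom.comp_apply,
      comp_aeval]
    congr 2
    funext j
    refine Fin.succAboveCases i ?_ (fun l => ?_) j
    · simp [chart]
    · rw [Function.comp_apply, ← Fin.succ_succAbove_succ, Fin.insertNth_apply_succAbove]
      simp [chart]
  rw [localEquation, monoidPoly, map_add, map_mul, aeval_X, h0, hs, hs]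

theorem rightEquivalent_localEquation {k : Type*} [Field k] [CharZero k]
    (f g : MvPolynomial (Fin 3) k) (p : Fin 4 → AlgebraicClosure k) (i : Fin 3)
    {A B P Q R : MvPolynomial (Fin 2) (AlgebraicClosure k)}
    (hAB : aeval (chart i fun l => p (i.succAbove l).succ / p i.succ) f = X 0 * A + X 1 * B)
    (hPQR : aeval (chart i fun l => p (i.succAbove l).succ / p i.succ) g +
        C (p 0 / p i.succ) * aeval (chart i fun l => p (i.succAbove l).succ / p i.succ) f =
      X 0 ^ 2 * P + X 0 * X 1 * Q + X 1 ^ 2 * R)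
    (hU : constantCoeff P * constantCoeff B ^ 2 - constantCoeff Q * constantCoeff A *
      constantCoeff B + constantCoeff R * constantCoeff A ^ 2 ≠ 0) :
    RightEquivalent (localEquation (monoidPoly f g) p i.succ :
      MvPowerSeries (Fin 3) (AlgebraicClosure k)) (normalFormA (AlgebraicClosure k) 1) := by
  have hc : ∀ r : MvPolynomial (Fin 2) (AlgebraicClosure k), MvPowerSeries.constantCoeff
      (rename Fin.succ r : MvPolynomial (Fin 3) (AlgebraicClosure k)).toMvPowerSeries =
        constantCoeff r := fun r => by
    refine Eq.trans ?_ (constantCoeff_rename Fin.succ r)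
    rw [constantCoeff_eq, ← MvPowerSeries.coeff_zero_eq_constantCoeff_apply, coeff_coe]
  have heq : localEquation (monoidPoly f g) p i.succ =
      X 0 * (X 1 * rename Fin.succ A + X 2 * rename Fin.succ B) +
        (X 1 ^ 2 * rename Fin.succ P + X 1 * X 2 * rename Fin.succ Q +
          X 2 ^ 2 * rename Fin.succ R) := by
    have h1 := congrArg (rename Fin.succ) hAB
    have h2 := congrArg (rename Fin.succ) hPQR
    simp only [map_add, map_mul, map_pow, rename_X, rename_C, Fin.succ_zero_eq_one,
      Fin.succ_one_eq_two] at h1 h2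
    rw [localEquation_monoidPoly]
    linear_combination h2 + X 0 * h1
  rw [heq]
  push_cast
  refine rightEquivalent_normalFormA_one _ _ _ _ _ ?_
  simpa only [hc] using hU

/-! ### Singular points of monoid surfaces -/

variable {k : Type*} [Field k] {d : ℕ} {f g : MvPolynomial (Fin 3) k}

theorem IsMonoidSurface.exists_aeval_pderiv_ne_zero (h : IsMonoidSurface d f g)
    {a : Fin 3 → AlgebraicClosure k} (ha : a ≠ 0) (hf : aeval a f = 0) (hg : aeval a g = 0)
    {q : AlgebraicClosure k} (hq : ∀ j, q * aeval a (pderiv j f) + aeval a (pderiv j g) = 0) :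
    ∃ j, aeval a (pderiv j f) ≠ 0 := by
  by_contra! hcon
  refine h.no_common_singular_point ⟨Projectivization.mk (AlgebraicClosure k) a ha, ?_⟩
  obtain ⟨c, hc⟩ := Projectivization.exists_smul_eq_mk_rep (AlgebraicClosure k) a ha
  have hg' : ∀ j, aeval a (pderiv j g) = 0 := fun j => by simpa [hcon] using hq j
  have hc' : (Projectivization.mk (AlgebraicClosure k) a ha).rep =
      (c : AlgebraicClosure k) • a := hc.symm
  rw [IsSingularPoint, IsSingularPoint, hc']
  exact ⟨⟨by rw [h.homogeneous_f.aeval_smul, hf, mul_zero],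
    fun j => by rw [h.homogeneous_f.pderiv.aeval_smul, hcon, mul_zero]⟩,
    ⟨by rw [h.homogeneous_g.aeval_smul, hg, mul_zero],
    fun j => by rw [h.homogeneous_g.pderiv.aeval_smul, hg', mul_zero]⟩⟩

/-- `O` is the only point at which `x₁`, `x₂`, `x₃` all vanish. -/
theorem tail_rep_ne_zero {P : ℙ (AlgebraicClosure k) (Fin 4 → AlgebraicClosure k)}
    (hP : P ≠ pointO k) : (fun j : Fin 3 => P.rep j.succ) ≠ 0 := by
  intro h
  apply hP
  rw [← P.mk_rep, pointO, Projectivization.mk_eq_mk_iff']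
  refine ⟨P.rep 0, ?_⟩
  funext j
  refine Fin.cases ?_ (fun l => ?_) j
  · simp
  · simpa using (congrFun h l).symm

theorem isSingularPoint_monoidPoly
    {P : ℙ (AlgebraicClosure k) (Fin 4 → AlgebraicClosure k)}
    (hP : IsSingularPoint (monoidPoly f g) P) :
    aeval (fun j : Fin 3 => P.rep j.succ) f = 0 ∧ aeval (fun j : Fin 3 => P.rep j.succ) g = 0 ∧
      ∀ j, P.rep 0 * aeval (fun j : Fin 3 => P.rep j.succ) (pderiv j f) +
        aeval (fun j : Fin 3 => P.rep j.succ) (pderiv j g) = 0 := by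
  obtain ⟨h0, hd⟩ := hP
  have hren : ∀ r : MvPolynomial (Fin 3) k, aeval P.rep (rename Fin.succ r) =
      aeval (fun j : Fin 3 => P.rep j.succ) r := fun r => by
    rw [aeval_rename]; rfl
  have hz : ∀ r : MvPolynomial (Fin 3) k, pderiv 0 (rename Fin.succ r) = 0 := fun r => by
    classical
    refine pderiv_eq_zero_of_notMem_vars fun hmem => ?_
    obtain ⟨j, -, hj⟩ := Finset.mem_image.1 (vars_rename Fin.succ r hmem)
    exact Fin.succ_ne_zero j hj
  have hf : aeval (fun j : Fin 3 => P.rep j.succ) f = 0 := by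
    have := hd 0
    rwa [monoidPoly, map_add, pderiv_mul, pderiv_X_self, hz, hz, one_mul, mul_zero, add_zero,
      add_zero, hren] at this
  refine ⟨hf, ?_, fun j => ?_⟩
  · rwa [monoidPoly, map_add, map_mul, aeval_X, hren, hren, hf, mul_zero, zero_add] at h0
  · have := hd j.succ
    rwa [monoidPoly, map_add, pderiv_mul, pderiv_X_of_ne (Fin.succ_ne_zero j).symm, zero_mul,
      zero_add, pderiv_rename (Fin.succ_injective 3), pderiv_rename (Fin.succ_injective 3),
      map_add, map_mul, aeval_X, hren, hren] at this

/-- Projection from `O` is injective on the other singular points: `p₀` is recovered from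
`p₀ ∇f(a) + ∇g(a) = 0`, as `∇f(a) ≠ 0`. -/
theorem eq_of_tail_rep_eq_smul (h : IsMonoidSurface d f g)
    {P P' : ℙ (AlgebraicClosure k) (Fin 4 → AlgebraicClosure k)}
    (hP : P ∈ otherSingularPoints f g) (hP' : P' ∈ otherSingularPoints f g)
    {c : AlgebraicClosure k} (hc : (fun j : Fin 3 => P.rep j.succ) =
      c • fun j : Fin 3 => P'.rep j.succ) : P = P' := by
  obtain ⟨-, -, hd⟩ := isSingularPoint_monoidPoly hP.1
  obtain ⟨hf', hg', hd'⟩ := isSingularPoint_monoidPoly hP'.1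
  obtain ⟨j, hj⟩ := h.exists_aeval_pderiv_ne_zero (tail_rep_ne_zero hP'.2) hf' hg' hd'
  have hc0 : c ≠ 0 := by
    rintro rfl
    exact tail_rep_ne_zero hP.2 (by rw [hc, zero_smul])
  have e1 := hd j
  have e2 := hd' j
  rw [hc, h.homogeneous_f.pderiv.aeval_smul, h.homogeneous_g.pderiv.aeval_smul] at e1
  have hd3 := h.three_le
  rw [show d - 1 = d - 1 - 1 + 1 by omega, Nat.add_sub_cancel, pow_succ] at e1
  have e3 : P.rep 0 = c * P'.rep 0 := by
    refine mul_right_cancel₀ (mul_ne_zero (pow_ne_zero (d - 1 - 1) hc0) hj) ?_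
    linear_combination e1 - c ^ (d - 1 - 1) * c * e2
  rw [← P.mk_rep, ← P'.mk_rep, Projectivization.mk_eq_mk_iff']
  refine ⟨c, ?_⟩
  funext l
  refine Fin.cases ?_ (fun l => ?_) l
  · exact e3.symm
  · exact (congrFun hc l).symm

/-- Below each singular point other than `O` runs an arc along which both curves vanish to order `2`, and
to order `3` unless the point is of type `A₁`. -/
theorem exists_arc_of_mem_otherSingularPoints [CharZero k] (h : IsMonoidSurface d f g)
    {P : ℙ (AlgebraicClosure k) (Fin 4 → AlgebraicClosure k)}
    (hP : P ∈ otherSingularPoints f g) :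
    ∃ (γ : Fin 3 → Polynomial (AlgebraicClosure k)) (e : ℕ),
      (∃ c : AlgebraicClosure k, c ≠ 0 ∧
        (fun j => (γ j).coeff 0) = c • fun j : Fin 3 => P.rep j.succ) ∧
      (fun j => (γ j).coeff 1) ∉
        Submodule.span (AlgebraicClosure k) {fun j => (γ j).coeff 0} ∧
      Polynomial.X ^ e ∣ aeval γ f ∧ Polynomial.X ^ e ∣ aeval γ g ∧
      2 ≤ e ∧ (¬ IsASingularity 1 (monoidPoly f g) P → 3 ≤ e) := by
  obtain ⟨hf, hg, hd⟩ := isSingularPoint_monoidPoly hP.1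
  have hd3 := h.three_le
  have ha := tail_rep_ne_zero hP.2
  obtain ⟨j, hj⟩ := h.exists_aeval_pderiv_ne_zero ha hf hg hd
  obtain ⟨i, hi⟩ := Function.ne_iff.1 ha
  change P.rep i.succ ≠ 0 at hi
  set a : Fin 3 → AlgebraicClosure k := fun j => P.rep j.succ
  have hpt := smul_eq_chartPoint (a := a) (i := i) hi
  set b : Fin 2 → AlgebraicClosure k := fun l => a (i.succAbove l) / a i with hb
  have hev : ∀ r : MvPolynomial (Fin 3) k, eval (chartPoint i b)
      (map (algebraMap k (AlgebraicClosure k)) r) = aeval ((a i)⁻¹ • a) r := fun r => by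
    rw [eval_map, hpt]; rfl
  have hch : ∀ r : MvPolynomial (Fin 3) k, aeval (chart i b)
      (map (algebraMap k (AlgebraicClosure k)) r) = aeval (chart i b) r := fun r =>
    aeval_map_algebraMap _ _ _
  have hi' : (a i)⁻¹ ≠ 0 := inv_ne_zero hi
  obtain ⟨A, B, Q1, Q2, Q3, hAB, hQ, hns⟩ := exists_local_form
    (f := map (algebraMap k (AlgebraicClosure k)) f)
    (g := map (algebraMap k (AlgebraicClosure k)) g) (i := i) (b := b)
    (q := P.rep 0 / a i) (h.homogeneous_f.map _)
    (by rw [hev, h.homogeneous_f.aeval_smul, hf, mul_zero])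
    (by rw [hev, h.homogeneous_g.aeval_smul, hg, mul_zero])
    (fun j => by
      rw [pderiv_map, pderiv_map, hev, hev, h.homogeneous_f.pderiv.aeval_smul,
        h.homogeneous_g.pderiv.aeval_smul, show d - 1 = d - 1 - 1 + 1 by omega,
        Nat.add_sub_cancel, pow_succ]
      linear_combination (a i)⁻¹ ^ (d - 1 - 1) * (a i)⁻¹ * hd j)
    ⟨j, by
      rw [pderiv_map, hev, h.homogeneous_f.pderiv.aeval_smul]
      exact mul_ne_zero (pow_ne_zero _ hi') hj⟩
  obtain ⟨γ, h0, h1, h3f, h2g, h3g⟩ := exists_arc_of_local_form hAB hQ hns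
  rw [aeval_map_algebraMap] at h3f h2g h3g
  rw [hch] at hAB
  rw [hch, hch] at hQ
  have hc : ∃ c : AlgebraicClosure k, c ≠ 0 ∧ (fun j => (γ j).coeff 0) = c • a :=
    ⟨_, hi', h0.trans hpt.symm⟩
  by_cases hU : constantCoeff Q1 * constantCoeff B ^ 2 - constantCoeff Q2 * constantCoeff A *
      constantCoeff B + constantCoeff Q3 * constantCoeff A ^ 2 = 0
  · exact ⟨γ, 3, hc, h1, h3f, h3g hU, by norm_num, fun _ => le_rfl⟩
  · refine ⟨γ, 2, hc, h1, (pow_dvd_pow _ (by norm_num)).trans h3f, h2g, le_rfl, fun hA => ?_⟩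
    exact absurd ⟨i.succ, hi, rightEquivalent_localEquation f g P.rep i hAB hQ hU⟩ hA

/-- The singular points other than `O` carry weights, lower bounds for the intersection multiplicities
of `Z(f)` and `Z(g)` below them, whose sums are bounded by Bézout's theorem. -/
theorem exists_weight_sum_le [CharZero k] (h : IsMonoidSurface d f g) :
    ∃ e : otherSingularPoints f g → ℕ,
      (∀ P, 2 ≤ e P ∧ (¬ IsASingularity 1 (monoidPoly f g) P.1 → 3 ≤ e P)) ∧
      ∀ T : Finset (otherSingularPoints f g), ∑ P ∈ T, e P ≤ d * (d - 1) := by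
  choose γ e hγ using fun P : otherSingularPoints f g =>
    exists_arc_of_mem_otherSingularPoints h P.2
  refine ⟨e, fun P => (hγ P).2.2.2.2, fun T => ?_⟩
  rw [← Finset.sum_coe_sort, mul_comm]
  have hinj := map_injective (σ := Fin 3) _ (algebraMap k (AlgebraicClosure k)).injective
  refine sum_le_mul_of_arcs (h.homogeneous_f.map (algebraMap k (AlgebraicClosure k)))
    (h.homogeneous_g.map (algebraMap k (AlgebraicClosure k)))
    ((map_ne_zero_iff _ hinj).2 h.g_ne_zero)
    (fun u => dvd_of_dvd_mul_map_of_isRelPrime h.gcd_eq_one)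
    (fun P : T => γ P) (fun P : T => e P) (fun P => ?_) (fun P => (hγ P).2.1)
    (fun P P' hne => ?_) (fun P => ?_) (fun P => ?_)
  · obtain ⟨c, hc, hcP⟩ := (hγ P).1
    rw [hcP]
    exact smul_ne_zero hc (tail_rep_ne_zero P.1.2.2)
  · obtain ⟨c, hc, hcP⟩ := (hγ P).1
    obtain ⟨c', -, hcP'⟩ := (hγ P').1
    rw [hcP, hcP', Submodule.mem_span_singleton]
    rintro ⟨x, hx⟩
    refine hne (Subtype.ext (Subtype.ext
      (eq_of_tail_rep_eq_smul h P.1.2 P'.1.2 (c := c⁻¹ * (x * c')) ?_)))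
    rw [mul_smul, mul_smul, hx, inv_smul_smul₀ hc]
  · rw [aeval_map_algebraMap]
    exact (hγ P).2.2.1
  · rw [aeval_map_algebraMap]
    exact (hγ P).2.2.2.1

end

end MonoidSurf

theorem mainTheorem2 {k : Type*} [Field k] [CharZero k] (d : ℕ) (f g : MvPolynomial (Fin 3) k)
    (h : MonoidSurf.IsMonoidSurface d f g) :
    (MonoidSurf.otherSingularPoints f g).Finite ∧
      (MonoidSurf.otherSingularPoints f g).ncard ≤ d * (d - 1) / 2 ∧
      ((MonoidSurf.otherSingularPoints f g).ncard = d * (d - 1) / 2 →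
        ∀ P ∈ MonoidSurf.otherSingularPoints f g,
          MonoidSurf.IsASingularity 1 (MonoidSurf.monoidPoly f g) P) := by
  obtain ⟨e, he, hsum⟩ := MonoidSurf.exists_weight_sum_le h
  have hcard : ∀ T : Finset (MonoidSurf.otherSingularPoints f g),
      2 * T.card ≤ d * (d - 1) := fun T => by
    refine le_trans ?_ (hsum T)
    rw [mul_comm, ← smul_eq_mul]
    exact Finset.card_nsmul_le_sum _ _ _ fun P _ => (he P).1
  have hfin : Finite (MonoidSurf.otherSingularPoints f g) := by
    by_contra hinf
    rw [not_finite_iff_infinite] at hinf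
    obtain ⟨T, hT⟩ := Infinite.exists_subset_card_eq
      (MonoidSurf.otherSingularPoints f g) (d * (d - 1) + 1)
    have := hcard T
    omega
  have := Fintype.ofFinite (MonoidSurf.otherSingularPoints f g)
  rw [← Nat.card_coe_set_eq, Nat.card_eq_fintype_card]
  refine ⟨hfin, ?_, fun heq P hP => ?_⟩
  · have := hcard Finset.univ
    rw [Finset.card_univ] at this
    omega
  · by_contra hA
    -- Every weight is at least `2` and the weight of `P` at least `3`, so their sum exceeds
    -- `d * (d - 1)`.
    have hlt : ∑ _Q : MonoidSurf.otherSingularPoints f g, 2 < ∑ Q, e Q :=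
      Finset.sum_lt_sum (fun Q _ => (he Q).1) ⟨⟨P, hP⟩, Finset.mem_univ _, (he ⟨P, hP⟩).2 hA⟩
    rw [Finset.sum_const, smul_eq_mul, Finset.card_univ, heq] at hlt
    have hev : d * (d - 1) / 2 * 2 = d * (d - 1) :=
      Nat.div_mul_cancel (Nat.even_mul_pred_self d).two_dvd
    have := hsum Finset.univ
    omega
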